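/- **Setting.** Let $N=\{1,\dots,n\}$ be a set of buyers with valuations $v_i>0$ per unit and public budgets $B_i>0$, and let $f:2^N\to\mathbb Z_+$ satisfy $f(\emptyset)=0$, $f(S)\le f(T)$ for $S\subseteq T$, $f(S\cup e)-f(S)\ge f(T\cup e)-f(T)$ for $S\subseteq T$ and $e\in N\setminus T$, and $f(N)=f(N\setminus i)$ for every $i\in N$. Write $x(S)=\sum_{i\in S}x_i$ and $P=\{x\in\mathbb R^N_+ : x(S)\le f(S)\ \forall S\subseteq N\}$. For $x,d\in\mathbb Z^N_+$, $i\in N$ and $w\ge 0$ put $$P_{x,d}=\{u\in\mathbb R^N_+ : x+u\in P,\ u\le d\},\qquad P^i_{x,d}(w)=\{u|_{N\setminus i} : u\in P_{x,d},\ u_i=w\}.$$ **Mechanism.** The buyers bid truthfully, i.e. buyer $i$ bids $v_i$. The polyhedral clinching auction for indivisible goods starts with $x_i=0$, $p_i=0$, $d_i=f(\{i\})+1$ $(i\in N)$ and price $c=0$. Buyer $i$ is active if $d_i>0$. While active buyers exist, repeat: 1. increase $c$ until there is an active buyer $j$ with $v_j=c$ or $d_j=(B_j-p_j)/c$; 2.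 while there is an active buyer $j$ with $v_j=c$, pick any such $j$, set $d_j:=0$, and run Clinching; 3. while there is an active buyer $j$ with $d_j=(B_j-p_j)/c$, pick any such $j$, set $d_j:=d_j-1$, and run Clinching. Clinching: for $i=1,\dots,n$ in this order, let $\delta_i$ be the largest nonnegative integer with $P^i_{x,d}(\delta_i)=P^i_{x,d}(0)$ for the current $x,d$, and set $x_i:=x_i+\delta_i$, $p_i:=p_i+c\,\delta_i$, $d_i:=d_i-\delta_i$. When no active buyer is left, the final allocation is $(x^{\rm f},p^{\rm f}):=(x,p)$. **Theorem 5.5.** However the buyers are picked in steps 2 and 3, the auction terminates, and the social welfare of its final allocation is at least the optimal liquid welfare: $$\mathrm{SW}^{\rm M}:=\sum_{i\in N}v_i x^{\rm f}_i\ \ge\ \mathrm{LW}^{\rm OPT}:=\max\Bigl\{\sum_{i\in N}\min(v_i x_i,B_i)\ :\ x\in P\cap\mathbb Z^N\Bigr\}.$$ -/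

import Mathlib

namespace ClinchingAuction

/-- Integer-valued monotone submodular set functions on the ground set `Fin n`
(the inequality of marginal values is written without subtraction). -/
structure IsMonotoneSubmodular {n : ℕ} (f : Finset (Fin n) → ℕ) : Prop where
  empty : f ∅ = 0
  mono : ∀ S T : Finset (Fin n), S ⊆ T → f S ≤ f T
  submodular : ∀ (S T : Finset (Fin n)) (e : Fin n), S ⊆ T → e ∉ T →
    f (insert e T) + f S ≤ f (insert e S) + f T

/-- All information accessible to the seller: the feasibility function `f`, the bids and the
public budgets of the buyers `Fin n`, under the standing assumptions of the model. -/
structure Input (n : ℕ) where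
  f : Finset (Fin n) → ℕ
  bid : Fin n → ℝ
  budget : Fin n → ℝ
  bid_pos : ∀ i, 0 < bid i
  budget_pos : ∀ i, 0 < budget i
  monotoneSubmodular : IsMonotoneSubmodular f
  /-- Competition: no single buyer is needed in order to sell all the goods. -/
  competition : ∀ i, f (Finset.univ.erase i) = f Finset.univ

/-- An allocation: numbers of units `x` and payments `p`. -/
structure Allocation (n : ℕ) where
  x : Fin n → ℕ
  p : Fin n → ℝ

/-- The polymatroid `P(f)`. -/
def polymatroid {n : ℕ} (f : Finset (Fin n) → ℕ) : Set (Fin n → ℝ) :=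
  {x | (∀ i, 0 ≤ x i) ∧ ∀ S : Finset (Fin n), ∑ i ∈ S, x i ≤ (f S : ℝ)}

/-- The remnant supply polytope `P_{x,d}`. -/
def remnantSupply {n : ℕ} (f : Finset (Fin n) → ℕ) (x d : Fin n → ℕ) : Set (Fin n → ℝ) :=
  {u | (∀ i, 0 ≤ u i) ∧ (fun i => (x i : ℝ) + u i) ∈ polymatroid f ∧ ∀ i, u i ≤ (d i : ℝ)}

/-- The polytope `P^i_{x,d}(w)` of the transactions that remain feasible for the buyers other
than `i` when buyer `i` gets `w` units. -/
def othersSupply {n : ℕ} (f : Finset (Fin n) → ℕ) (x d : Fin n → ℕ) (i : Fin n) (w : ℝ) :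
    Set ({j : Fin n // j ≠ i} → ℝ) :=
  (fun (u : Fin n → ℝ) (j : {j : Fin n // j ≠ i}) => u j) ''
    {u | u ∈ remnantSupply f x d ∧ u i = w}

/-- The clinching amount of buyer `i`: the largest nonnegative integer `w` with
`P^i_{x,d}(w) = P^i_{x,d}(0)`. The maximum exists whenever `x` is in the polymatroid, see
`isGreatest_clinchAmount`. -/
noncomputable def clinchAmount {n : ℕ} (f : Finset (Fin n) → ℕ) (x d : Fin n → ℕ)
    (i : Fin n) : ℕ :=
  sSup {w : ℕ | othersSupply f x d i (w : ℝ) = othersSupply f x d i 0}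

theorem clinch_le_demand {n : ℕ} {f : Finset (Fin n) → ℕ} {x d : Fin n → ℕ}
    (hx : (fun i => (x i : ℝ)) ∈ polymatroid f) (i : Fin n) {w : ℕ}
    (hw : othersSupply f x d i (w : ℝ) = othersSupply f x d i 0) : w ≤ d i := by
  have h0 : (fun _ => 0 : {j : Fin n // j ≠ i} → ℝ) ∈ othersSupply f x d i 0 :=
    ⟨fun _ => 0, ⟨⟨fun _ => le_rfl, by simpa using hx, fun j => by positivity⟩, rfl⟩, rfl⟩
  rw [← hw] at h0
  obtain ⟨u, ⟨hu, hui⟩, -⟩ := h0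
  have := hu.2.2 i
  rw [hui] at this
  exact_mod_cast this

/-- The clinching amount is a maximum; in particular, by `clinch_le_demand`, it is at most the
current demand. -/
theorem isGreatest_clinchAmount {n : ℕ} {f : Finset (Fin n) → ℕ} {x d : Fin n → ℕ}
    (hx : (fun i => (x i : ℝ)) ∈ polymatroid f) (i : Fin n) :
    IsGreatest {w : ℕ | othersSupply f x d i (w : ℝ) = othersSupply f x d i 0}
      (clinchAmount f x d i) := by
  have hb : BddAbove {w : ℕ | othersSupply f x d i (w : ℝ) = othersSupply f x d i 0} :=
    ⟨d i, fun w hw => clinch_le_demand hx i hw⟩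
  have hne : {w : ℕ | othersSupply f x d i (w : ℝ) = othersSupply f x d i 0}.Nonempty :=
    ⟨0, by simp⟩
  exact ⟨Nat.sSup_mem hne hb, fun w hw => le_csSup hb hw⟩

/-- The variables of the auction: units clinched so far, payments so far, demands, price clock. -/
structure State (n : ℕ) where
  x : Fin n → ℕ
  p : Fin n → ℝ
  d : Fin n → ℕ
  c : ℝ

/-- Buyer `i` is active if her demand is positive. -/
def State.Active {n : ℕ} (s : State n) (i : Fin n) : Prop := 0 < s.d i

/-- The initial state of the auction. -/
def initialState {n : ℕ} (f : Finset (Fin n) → ℕ) : State n where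
  x := fun _ => 0
  p := fun _ => 0
  d := fun i => f {i} + 1
  c := 0

/-- Buyer `i` clinches her clinching amount at the current price. (The truncated subtraction is
an honest one, since the clinching amount is at most the demand.) -/
noncomputable def clinchBuyer {n : ℕ} (f : Finset (Fin n) → ℕ) (s : State n) (i : Fin n) :
    State n where
  x := Function.update s.x i (s.x i + clinchAmount f s.x s.d i)
  p := Function.update s.p i (s.p i + s.c * (clinchAmount f s.x s.d i : ℝ))
  d := Function.update s.d i (s.d i - clinchAmount f s.x s.d i)
  c := s.c

/-- The clinching procedure: the buyers clinch one after the other, in the order `1, …, n`. -/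
noncomputable def clinching {n : ℕ} (f : Finset (Fin n) → ℕ) (s : State n) : State n :=
  (List.finRange n).foldl (clinchBuyer f) s

/-- Replace the demand of buyer `j` by `m`. -/
def State.setDemand {n : ℕ} (s : State n) (j : Fin n) (m : ℕ) : State n :=
  { s with d := Function.update s.d j m }

/-- Buyer `j` is active and the price `c` has reached her bid. -/
def BidReached {n : ℕ} (I : Input n) (s : State n) (c : ℝ) (j : Fin n) : Prop :=
  s.Active j ∧ I.bid j = c

/-- Buyer `j` is active and at price `c` her demand exhausts her remaining budget. (This is never
the case at `c = 0`, since the demand is positive and the quotient is then `0` in Lean.) -/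
def BudgetReached {n : ℕ} (I : Input n) (s : State n) (c : ℝ) (j : Fin n) : Prop :=
  s.Active j ∧ (s.d j : ℝ) = (I.budget j - s.p j) / c

/-- Position of the control in the auction: at the test of the outer loop, at the test of the
inner loop that handles the bids, or at the test of the inner loop that handles the budgets. -/
inductive Control
  | outer
  | bids
  | budgets

/-- One step of the polyhedral clinching auction. Buyers whose demand is updated are picked
nondeterministically. -/
inductive Step {n : ℕ} (I : Input n) : Control × State n → Control × State n → Prop
  /-- While active buyers exist, the price clock is increased until some active buyer reaches her
  bid or exhausts her budget. -/
  | raisePrice (s : State n) (c' : ℝ) (hactive : ∃ i, s.Active i)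
      (hc : IsLeast {c : ℝ | s.c ≤ c ∧ ∃ j, BidReached I s c j ∨ BudgetReached I s c j} c') :
      Step I (.outer, s) (.bids, { s with c := c' })
  | updateBid (s : State n) (j : Fin n) (hj : BidReached I s s.c j) :
      Step I (.bids, s) (.bids, clinching I.f (s.setDemand j 0))
  | exitBids (s : State n) (h : ¬ ∃ j, BidReached I s s.c j) :
      Step I (.bids, s) (.budgets, s)
  | updateBudget (s : State n) (j : Fin n) (hj : BudgetReached I s s.c j) :
      Step I (.budgets, s) (.budgets, clinching I.f (s.setDemand j (s.d j - 1)))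
  | exitBudgets (s : State n) (h : ¬ ∃ j, BudgetReached I s s.c j) :
      Step I (.budgets, s) (.outer, s)

/-- The configurations that some execution of the auction visits. -/
def Reachable {n : ℕ} (I : Input n) (a : Control × State n) : Prop :=
  Relation.ReflTransGen (Step I) (.outer, initialState I.f) a

/-- The auction has ended: the outer loop is left since no buyer is active. -/
def Ended {n : ℕ} (a : Control × State n) : Prop :=
  a.1 = .outer ∧ ¬ ∃ i, a.2.Active i

/-- Every execution of the auction is finite and runs on until the auction has ended. -/
def Terminates {n : ℕ} (I : Input n) : Prop :=
  Acc (fun b a => Step I a b) (.outer, initialState I.f) ∧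
    ∀ a, Reachable I a → Ended a ∨ ∃ b, Step I a b

/-- `A` is the final allocation of some execution of the auction. -/
def IsFinalAllocation {n : ℕ} (I : Input n) (A : Allocation n) : Prop :=
  ∃ a, Reachable I a ∧ Ended a ∧ A = ⟨a.2.x, a.2.p⟩

/-- Social welfare of an allocation for the valuations `v`. -/
def socialWelfare {n : ℕ} (v : Fin n → ℝ) (A : Allocation n) : ℝ :=
  ∑ i, v i * (A.x i : ℝ)

/-- Liquid welfare of the allocation `x` of goods, for valuations `v` and budgets `B`. -/
noncomputable def liquidWelfare {n : ℕ} (v B : Fin n → ℝ) (x : Fin n → ℕ) : ℝ :=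
  ∑ i, min (v i * (x i : ℝ)) (B i)

/-- The liquid welfare values of the feasible integral allocations of goods. -/
def liquidWelfareValues {n : ℕ} (f : Finset (Fin n) → ℕ) (v B : Fin n → ℝ) : Set ℝ :=
  {L | ∃ x : Fin n → ℕ, (fun i => (x i : ℝ)) ∈ polymatroid f ∧ liquidWelfare v B x = L}

/-- The optimal liquid welfare; the supremum is attained, see `isGreatest_optLiquidWelfare`. -/
noncomputable def optLiquidWelfare {n : ℕ} (f : Finset (Fin n) → ℕ) (v B : Fin n → ℝ) : ℝ :=
  sSup (liquidWelfareValues f v B)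

theorem isGreatest_optLiquidWelfare {n : ℕ} (f : Finset (Fin n) → ℕ) (v B : Fin n → ℝ) :
    IsGreatest (liquidWelfareValues f v B) (optLiquidWelfare f v B) := by
  have hfin : {x : Fin n → ℕ | (fun i => (x i : ℝ)) ∈ polymatroid f}.Finite := by
    refine (Set.finite_Iic (fun i => f {i})).subset fun x hx i => ?_
    have := hx.2 {i}
    simp only [Finset.sum_singleton] at this
    exact_mod_cast this
  have hset : liquidWelfareValues f v B =
      liquidWelfare v B '' {x : Fin n → ℕ | (fun i => (x i : ℝ)) ∈ polymatroid f} := rfl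
  have hne : (liquidWelfareValues f v B).Nonempty :=
    ⟨_, fun _ => 0, ⟨fun _ => by simp, fun S => by simp⟩, rfl⟩
  have hf : (liquidWelfareValues f v B).Finite := by rw [hset]; exact hfin.image _
  exact ⟨hne.csSup_mem hf, fun L hL => le_csSup hf.bddAbove hL⟩

end ClinchingAuction

namespace ClinchingAuction

variable {n : ℕ}

/-! A potential argument: the welfare already sold plus a bound on the welfare still to come never
falls below the optimum `L`. The bound is witnessed by an integral transaction `u` in the remnant
polytope and a liquid part `a ≤ u`. Liquid units count as `min (v a) (B - p)`, the others at the
current price `c`. At the start `c = 0` and `u = a` is an optimal allocation; at the end all demands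
vanish, hence `u = a = 0` and only social welfare remains.

Raising `c` helps, since `u - a ≥ 0`. A clinching buyer takes her units out of `a` first; nothing is
lost because `c ≤ v` and she can afford all her demand (`WelfareBound.clinchBuyer`). When a demand
is cut at a bid or a budget, the liquid units at stake are worth at most `c` each, so they may be
declared non-liquid (`WelfareBound.setDemand`). Non-liquid units all count `c`, so it only matters
that they can go to somebody else.

This last point is `exists_exchange`: if `j` can clinch nothing, each of her units can be moved to
another buyer. It applies because no buyer can clinch just before a cut: competition gives this at
the start, and each clinching round restores it (`settled_clinching`).

Each cut lowers the total demand, and only boundedly many steps separate two cuts; this gives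
termination. -/

/-! ### Submodularity and tight sets. -/

theorem IsMonotoneSubmodular.union_add_inter {f : Finset (Fin n) → ℕ}
    (hf : IsMonotoneSubmodular f) (S T : Finset (Fin n)) :
    f (S ∪ T) + f (S ∩ T) ≤ f S + f T := by
  -- The elements of `S \ T` are added one at a time to `S ∩ T` and to `T`, comparing marginal
  -- values.
  suffices h : ∀ (A R T : Finset (Fin n)), R ⊆ T → Disjoint A T →
      f (T ∪ A) + f R ≤ f (R ∪ A) + f T by
    have := h (S \ T) (S ∩ T) T Finset.inter_subset_right Finset.sdiff_disjoint
    rwa [Finset.union_sdiff_self_eq_union, Finset.union_comm T S, Finset.union_comm (S ∩ T),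
      Finset.sdiff_union_inter] at this
  intro A
  induction A using Finset.induction_on with
  | empty => intro R T _ _; simp [add_comm]
  | insert e A he ih =>
    intro R T hRT hd
    rw [Finset.disjoint_insert_left] at hd
    have h1 := ih R T hRT hd.2
    have h2 := hf.submodular (R ∪ A) (T ∪ A) e (Finset.union_subset_union_left hRT) (by
      simp [hd.1, he])
    rw [Finset.union_insert, Finset.union_insert]
    omega

/-- Tight sets of a point of the polymatroid are closed under union. -/
theorem tight_union {f : Finset (Fin n) → ℕ} (hf : IsMonotoneSubmodular f) {x : Fin n → ℕ}
    (hx : ∀ S, ∑ i ∈ S, x i ≤ f S) {S T : Finset (Fin n)}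
    (hS : ∑ i ∈ S, x i = f S) (hT : ∑ i ∈ T, x i = f T) :
    ∑ i ∈ S ∪ T, x i = f (S ∪ T) := by
  have h1 := hf.union_add_inter S T
  have h2 := Finset.sum_union_inter (s₁ := S) (s₂ := T) (f := x)
  have h3 := hx (S ∪ T)
  have h4 := hx (S ∩ T)
  omega

theorem tight_biUnion {f : Finset (Fin n) → ℕ} (hf : IsMonotoneSubmodular f) {x : Fin n → ℕ}
    (hx : ∀ S, ∑ i ∈ S, x i ≤ f S) (K : Finset (Fin n)) (T : Fin n → Finset (Fin n))
    (hT : ∀ k ∈ K, ∑ i ∈ T k, x i = f (T k)) :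
    ∑ i ∈ K.biUnion T, x i = f (K.biUnion T) := by
  induction K using Finset.induction_on with
  | empty => simp [hf.empty]
  | insert k K _ ih =>
    rw [Finset.biUnion_insert]
    exact tight_union hf hx (hT k (by simp)) (ih fun l hl => hT l (by simp [hl]))

/-! ### The remnant supply polytope and clinching amounts. -/

theorem natCast_mem_polymatroid {f : Finset (Fin n) → ℕ} {x : Fin n → ℕ} :
    (fun i => (x i : ℝ)) ∈ polymatroid f ↔ ∀ S, ∑ i ∈ S, x i ≤ f S := by
  constructor
  · intro h S
    have := h.2 S
    dsimp only at this
    exact_mod_cast this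
  · intro h
    exact ⟨fun i => by positivity, fun S => by dsimp only; exact_mod_cast h S⟩

theorem natCast_mem_remnantSupply {f : Finset (Fin n) → ℕ} {x d u : Fin n → ℕ} :
    (fun i => (u i : ℝ)) ∈ remnantSupply f x d ↔
      (∀ S, ∑ i ∈ S, (x i + u i) ≤ f S) ∧ ∀ i, u i ≤ d i := by
  have : (fun i => (x i : ℝ) + (u i : ℝ)) = fun i => ((x i + u i : ℕ) : ℝ) := by
    ext i; push_cast; rfl
  simp only [remnantSupply, Set.mem_ofPred_eq, this, natCast_mem_polymatroid, Nat.cast_le,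
    Nat.cast_nonneg, implies_true, true_and]

theorem remnantSupply_mono {f : Finset (Fin n) → ℕ} {x d : Fin n → ℕ} {u w : Fin n → ℝ}
    (hu : u ∈ remnantSupply f x d) (hw : ∀ i, 0 ≤ w i) (h : ∀ i, w i ≤ u i) :
    w ∈ remnantSupply f x d :=
  ⟨hw, ⟨fun i => add_nonneg (by positivity) (hw i),
    fun S => (Finset.sum_le_sum fun i _ => by linarith [h i]).trans (hu.2.1.2 S)⟩,
    fun i => (h i).trans (hu.2.2 i)⟩

/-- The polytope is downward closed, so `i` getting `w` units excludes nothing for the others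
exactly when coordinate `i` of any point may be overwritten by `w`. All later arguments use
clinching in this form. -/
theorem othersSupply_eq_iff {f : Finset (Fin n) → ℕ} {x d : Fin n → ℕ} {i : Fin n} {w : ℝ} :
    othersSupply f x d i w = othersSupply f x d i 0 ↔
      ∀ y ∈ remnantSupply f x d, Function.update y i w ∈ remnantSupply f x d := by
  constructor
  · intro h y hy
    have h0 : Function.update y i 0 ∈ remnantSupply f x d := by
      refine remnantSupply_mono hy (fun k => ?_) fun k => ?_ <;>
        rcases eq_or_ne k i with rfl | hk <;> simp_all [hy.1]
    have hmem : (fun j : {j : Fin n // j ≠ i} => Function.update y i 0 j) ∈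
        othersSupply f x d i 0 := ⟨_, ⟨h0, by simp⟩, rfl⟩
    rw [← h] at hmem
    obtain ⟨u, ⟨hu, hui⟩, he⟩ := hmem
    convert hu using 1
    ext k
    rcases eq_or_ne k i with rfl | hk
    · simp [hui]
    · have := congrFun he ⟨k, hk⟩
      simp_all
  · intro h
    ext z
    constructor
    · rintro ⟨u, ⟨hu, -⟩, rfl⟩
      refine ⟨Function.update u i 0, ⟨?_, by simp⟩, ?_⟩
      · refine remnantSupply_mono hu (fun k => ?_) fun k => ?_ <;>
          rcases eq_or_ne k i with rfl | hk <;> simp_all [hu.1]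
      · ext j; simp [Function.update_of_ne j.2]
    · rintro ⟨u, ⟨hu, -⟩, rfl⟩
      refine ⟨Function.update u i w, ⟨h u hu, by simp⟩, ?_⟩
      ext j; simp [Function.update_of_ne j.2]

theorem le_clinchAmount {f : Finset (Fin n) → ℕ} {x d : Fin n → ℕ}
    (hx : (fun i => (x i : ℝ)) ∈ polymatroid f) {i : Fin n} {w : ℕ}
    (h : ∀ y ∈ remnantSupply f x d, Function.update y i (w : ℝ) ∈ remnantSupply f x d) :
    w ≤ clinchAmount f x d i :=
  (isGreatest_clinchAmount hx i).2 (othersSupply_eq_iff.2 h)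

theorem update_mem_of_le_clinchAmount {f : Finset (Fin n) → ℕ} {x d : Fin n → ℕ}
    (hx : (fun i => (x i : ℝ)) ∈ polymatroid f) {i : Fin n} {w : ℝ} (hw : 0 ≤ w)
    (h : w ≤ clinchAmount f x d i) {y : Fin n → ℝ} (hy : y ∈ remnantSupply f x d) :
    Function.update y i w ∈ remnantSupply f x d := by
  have := othersSupply_eq_iff.1 (isGreatest_clinchAmount hx i).1 y hy
  refine remnantSupply_mono this (fun k => ?_) fun k => ?_ <;>
    rcases eq_or_ne k i with rfl | hk <;> simp_all [hy.1]

theorem clinchAmount_le {f : Finset (Fin n) → ℕ} {x d : Fin n → ℕ}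
    (hx : (fun i => (x i : ℝ)) ∈ polymatroid f) (i : Fin n) : clinchAmount f x d i ≤ d i :=
  clinch_le_demand hx i (isGreatest_clinchAmount hx i).1

/-- Allocating `δ` units to buyer `i` translates the remnant supply polytope. -/
theorem mem_remnantSupply_update {f : Finset (Fin n) → ℕ} {x d : Fin n → ℕ} {i : Fin n} {δ : ℕ}
    (hδ : δ ≤ d i) {u : Fin n → ℝ} :
    u ∈ remnantSupply f (Function.update x i (x i + δ)) (Function.update d i (d i - δ)) ↔
      (∀ k, 0 ≤ u k) ∧ Function.update u i (u i + δ) ∈ remnantSupply f x d := by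
  have e : (fun k => ((Function.update x i (x i + δ) k : ℕ) : ℝ) + u k) =
      fun k => (x k : ℝ) + Function.update u i (u i + δ) k := by
    ext k
    rcases eq_or_ne k i with rfl | hk
    · simp; ring
    · simp [hk]
  simp only [remnantSupply, Set.mem_ofPred_eq, e]
  constructor
  · rintro ⟨h0, h1, h2⟩
    refine ⟨h0, fun k => ?_, h1, fun k => ?_⟩
    · rcases eq_or_ne k i with rfl | hk
      · simpa using add_nonneg (h0 k) (Nat.cast_nonneg δ)
      · simpa [hk] using h0 k
    · have := h2 k
      rcases eq_or_ne k i with rfl | hk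
      · simp only [Function.update_self] at this ⊢
        rw [Nat.cast_sub hδ] at this; linarith
      · simpa [hk] using this
  · rintro ⟨h0, -, h1, h2⟩
    refine ⟨h0, h1, fun k => ?_⟩
    have := h2 k
    rcases eq_or_ne k i with rfl | hk
    · simp only [Function.update_self] at this ⊢
      rw [Nat.cast_sub hδ]; linarith
    · simpa [hk] using this

/-! ### A clinching round leaves nothing to clinch. -/

theorem clinchBuyer_mem_polymatroid {f : Finset (Fin n) → ℕ} {s : State n}
    (hx : (fun i => (s.x i : ℝ)) ∈ polymatroid f) (i : Fin n) :
    (fun k => ((clinchBuyer f s i).x k : ℝ)) ∈ polymatroid f := by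
  have h0 : (fun _ => 0 : Fin n → ℝ) ∈ remnantSupply f s.x s.d :=
    ⟨fun _ => le_rfl, by simpa using hx, fun j => by positivity⟩
  have := (update_mem_of_le_clinchAmount hx (Nat.cast_nonneg _) le_rfl (i := i) h0).2.1
  convert this using 2 with k
  rcases eq_or_ne k i with rfl | hk <;> simp [clinchBuyer, *]

theorem clinchAmount_clinchBuyer_self {f : Finset (Fin n) → ℕ} {s : State n}
    (hx : (fun i => (s.x i : ℝ)) ∈ polymatroid f) (i : Fin n) :
    clinchAmount f (clinchBuyer f s i).x (clinchBuyer f s i).d i = 0 := by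
  have hx' := clinchBuyer_mem_polymatroid hx i
  by_contra hne
  have h1 : (1 : ℝ) ≤ clinchAmount f (clinchBuyer f s i).x (clinchBuyer f s i).d i := by
    exact_mod_cast Nat.one_le_iff_ne_zero.2 hne
  have hle := clinchAmount_le (d := s.d) hx i
  -- A further unit after clinching `δ` would have made `δ + 1` clinchable at once, against
  -- maximality.
  have : clinchAmount f s.x s.d i + 1 ≤ clinchAmount f s.x s.d i := by
    refine le_clinchAmount hx fun y hy => ?_
    have hz : Function.update y i 0 ∈
        remnantSupply f (clinchBuyer f s i).x (clinchBuyer f s i).d := by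
      refine (mem_remnantSupply_update hle).2 ⟨fun k => ?_, ?_⟩
      · rcases eq_or_ne k i with rfl | hk <;> simp_all [hy.1]
      · simpa using update_mem_of_le_clinchAmount hx (Nat.cast_nonneg _) le_rfl hy
    have := ((mem_remnantSupply_update hle).1
      (update_mem_of_le_clinchAmount hx' zero_le_one h1 hz)).2
    simpa [add_comm] using this
  omega

/-- Clinching by `i` creates no opportunity for `j`, so a single pass over the buyers suffices. -/
theorem clinchAmount_clinchBuyer_of_eq_zero {f : Finset (Fin n) → ℕ} {s : State n}
    (hx : (fun i => (s.x i : ℝ)) ∈ polymatroid f) (i j : Fin n)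
    (hj : clinchAmount f s.x s.d j = 0) :
    clinchAmount f (clinchBuyer f s i).x (clinchBuyer f s i).d j = 0 := by
  rcases eq_or_ne j i with rfl | hji
  · exact clinchAmount_clinchBuyer_self hx j
  have hx' := clinchBuyer_mem_polymatroid hx i
  by_contra hne
  have h1 : (1 : ℝ) ≤ clinchAmount f (clinchBuyer f s i).x (clinchBuyer f s i).d j := by
    exact_mod_cast Nat.one_le_iff_ne_zero.2 hne
  have hle := clinchAmount_le (d := s.d) hx i
  set δ := clinchAmount f s.x s.d i with hδ
  have : 1 ≤ clinchAmount f s.x s.d j := by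
    refine le_clinchAmount hx fun y hy => ?_
    -- Raising `y i` to at least `δ` brings `y` into the range of the translation; there `j` can be
    -- set to one unit, and lowering coordinate `i` again is harmless.
    have hy1 : Function.update y i (max (y i) δ) ∈ remnantSupply f s.x s.d := by
      rcases le_total (y i) δ with h | h
      · rw [max_eq_right h]
        exact update_mem_of_le_clinchAmount hx (Nat.cast_nonneg _) le_rfl hy
      · rwa [max_eq_left h, Function.update_eq_self]
    have hz : Function.update y i (max (y i) δ - δ) ∈
        remnantSupply f (clinchBuyer f s i).x (clinchBuyer f s i).d := by
      refine (mem_remnantSupply_update hle).2 ⟨fun k => ?_, ?_⟩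
      · rcases eq_or_ne k i with rfl | hk
        · simp
        · simpa [hk] using hy.1 k
      · simpa using hy1
    have h2 := ((mem_remnantSupply_update hle).1
      (update_mem_of_le_clinchAmount hx' zero_le_one h1 hz)).2
    refine remnantSupply_mono h2 (fun k => ?_) fun k => ?_
    · rcases eq_or_ne k j with rfl | hk
      · simp
      · simpa [hk] using hy.1 k
    · rcases eq_or_ne k j with rfl | hk
      · simp [hji]
      · rcases eq_or_ne k i with rfl | hki <;> simp [*, hji.symm]
  omega

theorem foldl_clinchBuyer_settled {f : Finset (Fin n) → ℕ} (l : List (Fin n)) {s : State n}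
    (hx : (fun i => (s.x i : ℝ)) ∈ polymatroid f) {j : Fin n}
    (hj : j ∈ l ∨ clinchAmount f s.x s.d j = 0) :
    clinchAmount f (l.foldl (clinchBuyer f) s).x (l.foldl (clinchBuyer f) s).d j = 0 := by
  induction l generalizing s with
  | nil => simpa using hj
  | cons i l ih =>
    refine ih (clinchBuyer_mem_polymatroid hx i) ?_
    rcases hj with hj | hj
    · rcases List.mem_cons.1 hj with rfl | hj
      · exact Or.inr (clinchAmount_clinchBuyer_self hx j)
      · exact Or.inl hj
    · exact Or.inr (clinchAmount_clinchBuyer_of_eq_zero hx i j hj)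

/-- No buyer can clinch anything. -/
def Settled (f : Finset (Fin n) → ℕ) (s : State n) : Prop :=
  ∀ j, clinchAmount f s.x s.d j = 0

theorem settled_clinching {f : Finset (Fin n) → ℕ} {s : State n}
    (hx : (fun i => (s.x i : ℝ)) ∈ polymatroid f) : Settled f (clinching f s) :=
  fun j => foldl_clinchBuyer_settled _ hx (Or.inl (List.mem_finRange j))

/-! ### Handing over units, and the role of competition. -/

/-- If the unit vector of `k` cannot be added to a point of the polymatroid, then `k` lies in a
tight set. -/
theorem exists_tight {f : Finset (Fin n) → ℕ} {z : Fin n → ℕ} {k : Fin n}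
    (hz : ∀ S, ∑ i ∈ S, z i ≤ f S)
    (h : ¬ ∀ S, ∑ i ∈ S, Function.update z k (z k + 1) i ≤ f S) :
    ∃ T, k ∈ T ∧ ∑ i ∈ T, z i = f T := by
  push Not at h
  obtain ⟨T, hT⟩ := h
  have hk : k ∈ T := by
    by_contra hk
    rw [Finset.sum_update_of_notMem hk] at hT
    exact absurd (hz T) (by omega)
  refine ⟨T, hk, ?_⟩
  rw [Finset.sum_update_of_mem hk] at hT
  have h1 := Finset.sum_sdiff (Finset.singleton_subset_iff.2 hk) (f := z)
  rw [Finset.sum_singleton] at h1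
  have := hz T
  omega

/-- If buyer `j` cannot clinch anything, a unit that is assigned to her can be handed over to
another buyer. -/
theorem exists_exchange {f : Finset (Fin n) → ℕ} (hf : IsMonotoneSubmodular f)
    {x d u : Fin n → ℕ} {j : Fin n} (hj : clinchAmount f x d j = 0)
    (hu : (fun i => (u i : ℝ)) ∈ remnantSupply f x d) (huj : 0 < u j) :
    ∃ k, k ≠ j ∧ (fun i => ((Function.update (Function.update u j (u j - 1)) k (u k + 1) i : ℕ) :
      ℝ)) ∈ remnantSupply f x d := by
  by_contra! hno
  obtain ⟨hu1, hu2⟩ := natCast_mem_remnantSupply.1 hu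
  have hx : (fun i => (x i : ℝ)) ∈ polymatroid f :=
    natCast_mem_polymatroid.2 fun S =>
      (Finset.sum_le_sum fun i _ => Nat.le_add_right _ _).trans (hu1 S)
  -- The load after `j` has returned one unit. If no `k` with spare demand can take it, each such
  -- `k` lies in a set tight for `z`; `U` will be the union of these sets.
  set z : Fin n → ℕ := fun i => x i + Function.update u j (u j - 1) i with hzdef
  have hzle : ∀ i, z i ≤ x i + u i := fun i => by
    rcases eq_or_ne i j with rfl | hi <;> simp [z, *]
  have hz : ∀ S, ∑ i ∈ S, z i ≤ f S := fun S =>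
    (Finset.sum_le_sum fun i _ => hzle i).trans (hu1 S)
  have hzj : z j + 1 = x j + u j := by simp [hzdef]; omega
  have hzk : ∀ k, k ≠ j → z k = x k + u k := fun k hk => by simp [hzdef, hk]
  have htight : ∀ k, k ≠ j → u k < d k → ∃ T, k ∈ T ∧ ∑ i ∈ T, z i = f T := by
    intro k hk hkd
    refine exists_tight hz fun h => hno k hk (natCast_mem_remnantSupply.2 ⟨fun S => ?_, fun i => ?_⟩)
    · refine le_trans (le_of_eq (Finset.sum_congr rfl fun i _ => ?_)) (h S)
      rcases eq_or_ne i k with rfl | hik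
      · simp [hzdef, hk]; ring
      · simp [hzdef, hik]
    · rcases eq_or_ne i k with rfl | hik
      · simpa using hkd
      · rcases eq_or_ne i j with rfl | hij
        · simp only [Function.update_of_ne hik, Function.update_self]
          exact (Nat.sub_le _ _).trans (hu2 i)
        · simpa [hik, hij] using hu2 i
  choose! T hT using fun (k : Fin n) (h : k ≠ j ∧ u k < d k) => htight k h.1 h.2
  set U := (Finset.univ.filter fun k => k ≠ j ∧ u k < d k).biUnion T with hU
  have hUt : ∑ i ∈ U, z i = f U := tight_biUnion hf hz _ T fun k hk => (hT k (by simpa using hk)).2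
  have hUmem : ∀ k, k ≠ j → u k < d k → k ∈ U := fun k h1 h2 =>
    Finset.mem_biUnion.2 ⟨k, by simp [h1, h2], (hT k ⟨h1, h2⟩).1⟩
  -- Otherwise giving the unit back to `j` would overload the tight set `U`.
  have hjU : j ∉ U := by
    intro hjU
    have h1 : ∑ i ∈ U, z i < ∑ i ∈ U, (x i + u i) :=
      Finset.sum_lt_sum (fun i _ => hzle i) ⟨j, hjU, by omega⟩
    exact absurd (hu1 U) (by omega)
  have hUt' : ∑ i ∈ U, (x i + u i) = f U := by
    rw [← hUt]
    exact Finset.sum_congr rfl fun i hi => (hzk i (by rintro rfl; exact hjU hi)).symm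
  -- Contradiction: `j` could clinch a unit. On `S ∩ U` the point `y` is unchanged; on `S \ U` it is
  -- dominated by `u`, as all buyers there except `j` have exhausted demand. Submodularity and
  -- tightness of `U` join the two bounds.
  have : 1 ≤ clinchAmount f x d j := by
    refine le_clinchAmount hx fun y hy => ?_
    have hyd : ∀ k, k ≠ j → k ∉ U → y k ≤ u k := fun k h1 h2 => by
      have : d k ≤ u k := not_lt.1 fun h => h2 (hUmem k h1 h)
      exact (hy.2.2 k).trans (by exact_mod_cast this)
    have hun : ∀ i, 0 ≤ Function.update y j ((1 : ℕ) : ℝ) i := fun i => by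
      rcases eq_or_ne i j with rfl | hi
      · simp
      · simpa [hi] using hy.1 i
    refine ⟨hun, ⟨fun i => add_nonneg (by positivity) (hun i), fun S => ?_⟩, fun i => ?_⟩
    · have e1 := hf.union_add_inter S U
      have e2 := hu1 (S ∪ U)
      have e3 : ∑ i ∈ S ∪ U, (x i + u i) = ∑ i ∈ S \ U, (x i + u i) + ∑ i ∈ U, (x i + u i) := by
        rw [← Finset.sdiff_union_self_eq_union, Finset.sum_union Finset.sdiff_disjoint]
      have e4 : ∑ i ∈ S \ U, (x i + u i) + f (S ∩ U) ≤ f S := by omega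
      have e5 : (∑ i ∈ S \ U, ((x i : ℝ) + u i)) + f (S ∩ U) ≤ f S := by exact_mod_cast e4
      rw [← Finset.sum_inter_add_sum_sdiff S U]
      have e6 : ∑ i ∈ S ∩ U, ((x i : ℝ) + Function.update y j ((1 : ℕ) : ℝ) i) ≤ f (S ∩ U) := by
        refine le_trans (le_of_eq (Finset.sum_congr rfl fun i hi => ?_)) (hy.2.1.2 (S ∩ U))
        rw [Function.update_of_ne]
        rintro rfl
        exact hjU (Finset.mem_inter.1 hi).2
      have e7 : ∑ i ∈ S \ U, ((x i : ℝ) + Function.update y j ((1 : ℕ) : ℝ) i) ≤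
          ∑ i ∈ S \ U, ((x i : ℝ) + u i) := by
        refine Finset.sum_le_sum fun i hi => ?_
        rcases eq_or_ne i j with rfl | hij
        · simpa using Nat.succ_le_of_lt huj
        · simpa [hij] using hyd i hij (Finset.mem_sdiff.1 hi).2
      linarith
    · rcases eq_or_ne i j with rfl | hi
      · simpa using (Nat.succ_le_of_lt huj).trans (hu2 i)
      · simpa [hi] using hy.2.2 i
  omega

/-- The other buyers can absorb the whole supply by competition, and then nothing is left for `i`.
-/
theorem settled_initialState (I : Input n) : Settled I.f (initialState I.f) := by
  intro i
  have hf := I.monotoneSubmodular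
  have hx : (fun k => ((initialState I.f).x k : ℝ)) ∈ polymatroid I.f :=
    natCast_mem_polymatroid.2 fun S => by simp [initialState]
  by_contra hne
  have h1 : (1 : ℝ) ≤ clinchAmount I.f (initialState I.f).x (initialState I.f).d i := by
    exact_mod_cast Nat.one_le_iff_ne_zero.2 hne
  have hfin : {y : Fin n → ℕ | (∀ S, ∑ k ∈ S, y k ≤ I.f S) ∧ y i = 0}.Finite :=
    (Set.finite_Iic fun k => I.f {k}).subset fun y hy k => by simpa using hy.1 {k}
  -- By maximality every buyer except `i` lies in a tight set, so `y` sells at least `f (univ.erase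
  -- i) = f univ` units.
  obtain ⟨y, ⟨hy, hyi⟩, hmax⟩ := hfin.exists_maximal ⟨fun _ => 0, by simp⟩
  have htight : ∀ k, k ≠ i → ∃ T, k ∈ T ∧ ∑ l ∈ T, y l = I.f T := by
    intro k hk
    refine exists_tight hy fun h => ?_
    have := hmax (y := Function.update y k (y k + 1)) ⟨h, by simp [hk.symm, hyi]⟩
      (by simp [Pi.le_def, Function.update_apply]; intro l; split_ifs <;> simp_all) k
    simp at this
  choose! T hT using htight
  have hU := tight_biUnion hf hy (Finset.univ.erase i) T fun k hk => (hT k (by simpa using hk)).2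
  have hsub : Finset.univ.erase i ⊆ (Finset.univ.erase i).biUnion T := fun k hk =>
    Finset.mem_biUnion.2 ⟨k, hk, (hT k (by simpa using hk)).1⟩
  have hle := hf.mono _ _ hsub
  rw [I.competition, ← hU] at hle
  have hyQ : (fun k => (y k : ℝ)) ∈ remnantSupply I.f (initialState I.f).x (initialState I.f).d :=
    natCast_mem_remnantSupply.2 ⟨by simpa [initialState] using hy, fun k => by
      simpa [initialState] using (hy {k}).trans (Nat.le_succ _)⟩
  have hmem := update_mem_of_le_clinchAmount hx zero_le_one h1 hyQ
  have e : Function.update (fun k => (y k : ℝ)) i 1 =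
      fun k => ((Function.update y i 1 k : ℕ) : ℝ) := by
    ext k
    rcases eq_or_ne k i with rfl | hk <;> simp [*]
  rw [e, natCast_mem_remnantSupply] at hmem
  have h2 := hmem.1 Finset.univ
  simp only [initialState, zero_add, Finset.sum_update_of_mem (Finset.mem_univ i)] at h2
  have h3 : ∑ k ∈ (Finset.univ.erase i).biUnion T, y k ≤ ∑ k, y k :=
    Finset.sum_le_sum_of_subset (Finset.subset_univ _)
  have h4 := Finset.sum_sdiff (Finset.subset_univ {i}) (f := y)
  rw [Finset.sum_singleton, hyi] at h4
  omega

/-! ### The welfare bound and its behaviour under clinching. -/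

/-- The part of buyer `i` in the bound on the welfare that is still to come, if she gets `u` more
units: `a` of them count with their liquid value, the others with the current price. -/
noncomputable def surplusBound (I : Input n) (s : State n) (i : Fin n) (u a : ℕ) : ℝ :=
  min (I.bid i * a) (I.budget i - s.p i) + s.c * (u - a)

/-- The current social welfare together with the welfare that is still to come is at least `L`. -/
def WelfareBound (I : Input n) (s : State n) (L : ℝ) : Prop :=
  ∃ u a : Fin n → ℕ, (fun i => (u i : ℝ)) ∈ remnantSupply I.f s.x s.d ∧ (∀ i, a i ≤ u i) ∧
    L ≤ ∑ i, (I.bid i * s.x i + surplusBound I s i (u i) (a i))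

/-- The facts about prices and demands that hold throughout the auction. -/
structure Consistent (I : Input n) (s : State n) : Prop where
  price_nonneg : 0 ≤ s.c
  price_le_bid : ∀ i, s.Active i → s.c ≤ I.bid i
  demand_le : ∀ i, s.c * s.d i ≤ I.budget i - s.p i
  budget_pos : ∀ i, s.Active i → 0 < I.budget i - s.p i

theorem Consistent.budget_nonneg {I : Input n} {s : State n} (h : Consistent I s) (i : Fin n) :
    0 ≤ I.budget i - s.p i :=
  (mul_nonneg h.price_nonneg (Nat.cast_nonneg _)).trans (h.demand_le i)

theorem WelfareBound.mem_polymatroid {I : Input n} {s : State n} {L : ℝ}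
    (h : WelfareBound I s L) : (fun i => (s.x i : ℝ)) ∈ polymatroid I.f := by
  obtain ⟨u, a, hu, -, -⟩ := h
  exact natCast_mem_polymatroid.2 fun S => (Finset.sum_le_sum fun i _ => Nat.le_add_right _ _).trans
    ((natCast_mem_remnantSupply.1 hu).1 S)

theorem consistent_initialState (I : Input n) : Consistent I (initialState I.f) where
  price_nonneg := le_rfl
  price_le_bid i _ := (I.bid_pos i).le
  demand_le i := by simpa [initialState] using (I.budget_pos i).le
  budget_pos i _ := by simpa [initialState] using I.budget_pos i

theorem welfareBound_initialState (I : Input n) :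
    WelfareBound I (initialState I.f) (optLiquidWelfare I.f I.bid I.budget) := by
  obtain ⟨⟨a, ha, hL⟩, -⟩ := isGreatest_optLiquidWelfare I.f I.bid I.budget
  have ha' := natCast_mem_polymatroid.1 ha
  refine ⟨a, a, natCast_mem_remnantSupply.2 ⟨by simpa [initialState] using ha', fun k => by
      simpa [initialState] using (ha' {k}).trans (Nat.le_succ _)⟩, fun _ => le_rfl, ?_⟩
  rw [← hL]
  simp [initialState, surplusBound, liquidWelfare]

theorem Consistent.clinchBuyer {I : Input n} {s : State n} (h : Consistent I s)
    (hx : (fun i => (s.x i : ℝ)) ∈ polymatroid I.f) (i : Fin n) :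
    Consistent I (clinchBuyer I.f s i) := by
  have hle := clinchAmount_le (d := s.d) hx i
  have hact : ∀ k, (ClinchingAuction.clinchBuyer I.f s i).Active k → s.Active k := by
    intro k hk
    rcases eq_or_ne k i with rfl | hki
    · simp only [State.Active, ClinchingAuction.clinchBuyer, Function.update_self] at hk ⊢
      omega
    · simpa [State.Active, ClinchingAuction.clinchBuyer, hki] using hk
  refine ⟨h.price_nonneg, fun k hk => h.price_le_bid k (hact k hk), fun k => ?_, fun k hk => ?_⟩
  · rcases eq_or_ne k i with rfl | hki
    · simp only [ClinchingAuction.clinchBuyer, Function.update_self]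
      rw [Nat.cast_sub hle]
      linarith [h.demand_le k]
    · simpa [ClinchingAuction.clinchBuyer, hki] using h.demand_le k
  · have hb := h.budget_pos k (hact k hk)
    rcases eq_or_ne k i with rfl | hki
    · have hd := h.demand_le k
      simp only [State.Active, ClinchingAuction.clinchBuyer, Function.update_self] at hk ⊢
      -- A buyer who stays active clinches less than her full demand, so she keeps money; at price
      -- zero she pays nothing.
      have hlt : (clinchAmount I.f s.x s.d k : ℝ) < s.d k := by
        exact_mod_cast Nat.lt_of_sub_pos hk
      rcases h.price_nonneg.eq_or_lt with h0 | h0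
      · rw [← h0]; linarith
      · nlinarith [mul_lt_mul_of_pos_left hlt h0]
    · simpa [ClinchingAuction.clinchBuyer, hki] using hb

theorem WelfareBound.clinchBuyer {I : Input n} {s : State n} {L : ℝ} (h : WelfareBound I s L)
    (hs : Consistent I s) (i : Fin n) : WelfareBound I (clinchBuyer I.f s i) L := by
  have hx := h.mem_polymatroid
  obtain ⟨u, a, hu, hau, hL⟩ := h
  have hle := clinchAmount_le (d := s.d) hx i
  set δ := clinchAmount I.f s.x s.d i with hδ
  have hmem : Function.update (fun k => (u k : ℝ)) i (max (u i) δ : ℕ) ∈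
      remnantSupply I.f s.x s.d := by
    rcases le_total (u i) δ with h | h
    · rw [max_eq_right h]
      exact update_mem_of_le_clinchAmount hx (Nat.cast_nonneg _) le_rfl hu
    · rw [max_eq_left h]
      have := Function.update_eq_self i (fun k => (u k : ℝ))
      rwa [this]
  -- The clinched units come out of the liquid part first, whence the truncated `a i - δ`. If `u i <
  -- δ`, then `u i` is first raised to `δ`, which clinching permits.
  refine ⟨Function.update u i (max (u i) δ - δ), Function.update a i (a i - δ), ?_, fun k => ?_,
    hL.trans (Finset.sum_le_sum fun k _ => ?_)⟩
  · refine (mem_remnantSupply_update hle).2 ⟨fun k => by positivity, ?_⟩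
    convert hmem using 1
    ext k
    rcases eq_or_ne k i with rfl | hk
    · simp only [Function.update_self]
      rw [Nat.cast_sub (le_max_right _ _), sub_add_cancel]
    · simp [hk]
  · rcases eq_or_ne k i with rfl | hk
    · simp only [Function.update_self]
      exact Nat.sub_le_sub_right ((hau k).trans (le_max_left _ _)) _
    · simpa [hk] using hau k
  · rcases eq_or_ne k i with rfl | hk
    swap
    · simp [ClinchingAuction.clinchBuyer, surplusBound, hk]
    simp only [ClinchingAuction.clinchBuyer, surplusBound, Function.update_self, ← hδ]
    have hc := hs.price_nonneg
    have hv : s.c * δ ≤ I.bid k * δ := by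
      rcases Nat.eq_zero_or_pos δ with h0 | h0
      · simp [h0]
      · exact mul_le_mul_of_nonneg_right (hs.price_le_bid k (h0.trans_le hle)) (Nat.cast_nonneg _)
    have hb : s.c * δ ≤ I.budget k - s.p k :=
      (mul_le_mul_of_nonneg_left (by exact_mod_cast hle) hc).trans (hs.demand_le k)
    rw [Nat.cast_sub (le_max_right _ _)]
    have hm : s.c * (u k : ℝ) ≤ s.c * ((max (u k) δ : ℕ) : ℝ) :=
      mul_le_mul_of_nonneg_left (by exact_mod_cast le_max_left _ _) hc
    push_cast at hm ⊢
    rcases le_total (a k) δ with haδ | haδ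
    · rw [Nat.sub_eq_zero_of_le haδ]
      have h1 : (I.bid k - s.c) * a k ≤ (I.bid k - s.c) * δ := by
        rcases Nat.eq_zero_or_pos δ with h0 | h0
        · simp [h0, Nat.le_zero.1 (h0 ▸ haδ)]
        · exact mul_le_mul_of_nonneg_left (by exact_mod_cast haδ)
            (sub_nonneg.2 (hs.price_le_bid k (h0.trans_le hle)))
      have h2 := min_le_left (I.bid k * a k) (I.budget k - s.p k)
      have h3 : I.bid k * ((0 : ℕ) : ℝ) ≤ I.budget k - (s.p k + s.c * δ) := by
        rw [Nat.cast_zero, mul_zero]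
        linarith
      rw [min_eq_left h3]
      push_cast
      have h4 : s.c * ((u k : ℝ) - a k) = s.c * u k - s.c * a k := mul_sub _ _ _
      linarith
    · rw [Nat.cast_sub haδ]
      rcases le_total (I.bid k * ((a k : ℝ) - δ)) (I.budget k - (s.p k + s.c * δ)) with h3 | h3
      · have h2 := min_le_left (I.bid k * a k) (I.budget k - s.p k)
        rw [min_eq_left h3]
        linarith
      · have h2 := min_le_right (I.bid k * a k) (I.budget k - s.p k)
        rw [min_eq_right h3]
        linarith

theorem foldl_clinchBuyer_invariant {I : Input n} {L : ℝ} (l : List (Fin n)) {s : State n}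
    (hs : Consistent I s) (h : WelfareBound I s L) :
    Consistent I (l.foldl (clinchBuyer I.f) s) ∧ WelfareBound I (l.foldl (clinchBuyer I.f) s) L := by
  induction l generalizing s with
  | nil => exact ⟨hs, h⟩
  | cons i l ih => exact ih (hs.clinchBuyer h.mem_polymatroid i) (h.clinchBuyer hs i)

/-! ### Cutting a demand. -/

theorem Consistent.setDemand {I : Input n} {s : State n} (hs : Consistent I s) {j : Fin n} {m : ℕ}
    (hm : m ≤ s.d j) : Consistent I (s.setDemand j m) := by
  have hd : ∀ k, (s.setDemand j m).d k ≤ s.d k := fun k => by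
    rcases eq_or_ne k j with rfl | hk <;> simp [State.setDemand, *]
  exact ⟨hs.price_nonneg, fun k hk => hs.price_le_bid k (hk.trans_le (hd k)),
    fun k => (mul_le_mul_of_nonneg_left (by exact_mod_cast hd k) hs.price_nonneg).trans
      (hs.demand_le k), fun k hk => hs.budget_pos k (hk.trans_le (hd k))⟩

theorem mem_remnantSupply_setDemand {f : Finset (Fin n) → ℕ} {s : State n} {u : Fin n → ℕ}
    {j : Fin n} {m : ℕ} (hu : (fun i => (u i : ℝ)) ∈ remnantSupply f s.x s.d) (hm : u j ≤ m) :
    (fun i => (u i : ℝ)) ∈ remnantSupply f (s.setDemand j m).x (s.setDemand j m).d := by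
  refine ⟨hu.1, hu.2.1, fun i => ?_⟩
  rcases eq_or_ne i j with rfl | hi
  · simpa [State.setDemand] using hm
  · simpa [State.setDemand, hi] using hu.2.2 i

/-- In a settled state, a unit beyond the liquid part `a` of the units assigned to buyer `j` can be
handed over to another buyer without loss. -/
theorem exists_exchange_surplusBound {I : Input n} {s : State n} (hset : Settled I.f s)
    {u a : Fin n → ℕ} (hu : (fun i => (u i : ℝ)) ∈ remnantSupply I.f s.x s.d)
    (hau : ∀ i, a i ≤ u i) {j : Fin n} (hj : a j < u j) :
    ∃ u' : Fin n → ℕ, (fun i => (u' i : ℝ)) ∈ remnantSupply I.f s.x s.d ∧ (∀ i, a i ≤ u' i) ∧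
      u' j = u j - 1 ∧
      ∑ i, (I.bid i * s.x i + surplusBound I s i (u' i) (a i)) =
        ∑ i, (I.bid i * s.x i + surplusBound I s i (u i) (a i)) := by
  obtain ⟨k, hkj, hk⟩ := exists_exchange I.monotoneSubmodular (hset j) hu (by omega)
  refine ⟨_, hk, fun i => ?_, by simp [hkj.symm], ?_⟩
  · have := hau i
    simp only [Function.update_apply]
    split_ifs with h1 h2
    · subst h1; omega
    · subst h2; omega
    · exact this
  · have hsum : ∑ i, Function.update (Function.update u j (u j - 1)) k (u k + 1) i = ∑ i, u i := by
      rw [Finset.sum_update_of_mem (Finset.mem_univ k),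
        Finset.sum_update_of_mem (by simpa using hkj.symm)]
      have h1 := Finset.sum_sdiff (Finset.subset_univ {k}) (f := u)
      have h2 := Finset.sum_sdiff (s₁ := {j}) (s₂ := Finset.univ \ {k}) (by simpa using hkj.symm)
        (f := u)
      simp only [Finset.sum_singleton] at h1 h2
      omega
    have hsum' : ∑ i, ((Function.update (Function.update u j (u j - 1)) k (u k + 1) i : ℕ) : ℝ) =
        ∑ i, (u i : ℝ) := by exact_mod_cast hsum
    simp only [surplusBound, mul_sub, Finset.sum_add_distrib, Finset.sum_sub_distrib,
      ← Finset.mul_sum, hsum']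

/-- Buyer `j` can be made to give up her liquid part if it is worth no more than its price. -/
theorem WelfareBound.setDemand {I : Input n} {s : State n} {L : ℝ} (h : WelfareBound I s L)
    (hs : Consistent I s) (hset : Settled I.f s) {j : Fin n} {m : ℕ}
    (hm : ∀ a : ℕ, a ≤ s.d j → m < a →
      min (I.bid j * a) (I.budget j - s.p j) ≤ s.c * a) :
    WelfareBound I (s.setDemand j m) L := by
  -- Once `a j ≤ m`, every unit above `m` is non-liquid; they are handed over one at a time, by
  -- induction on `u j`.
  have key : ∀ (r : ℕ) (u a : Fin n → ℕ), u j = r →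
      (fun i => (u i : ℝ)) ∈ remnantSupply I.f s.x s.d → (∀ i, a i ≤ u i) → a j ≤ m →
      L ≤ ∑ i, (I.bid i * s.x i + surplusBound I s i (u i) (a i)) →
      WelfareBound I (s.setDemand j m) L := by
    intro r
    induction r with
    | zero =>
      intro u a hr hu hau _ hL
      exact ⟨u, a, mem_remnantSupply_setDemand hu (by omega), hau, hL⟩
    | succ r ih =>
      intro u a hr hu hau haj hL
      by_cases hle : u j ≤ m
      · exact ⟨u, a, mem_remnantSupply_setDemand hu hle, hau, hL⟩
      · obtain ⟨u', hu', hau', hr', hL'⟩ := exists_exchange_surplusBound hset hu hau (j := j)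
          (by omega)
        exact ih u' a (by omega) hu' hau' haj (hL'.symm ▸ hL)
  obtain ⟨u, a, hu, hau, hL⟩ := h
  by_cases haj : a j ≤ m
  · exact key _ u a rfl hu hau haj hL
  -- The whole liquid part is given up: by `hm` it is worth at most `c * a j`.
  · refine key _ u (Function.update a j 0) rfl hu (fun i => ?_) (by simp)
      (hL.trans (Finset.sum_le_sum fun i _ => ?_))
    · rcases eq_or_ne i j with rfl | hi <;> simp [*]
    · rcases eq_or_ne i j with rfl | hi
      · have h1 := hm (a i) ((hau i).trans ((natCast_mem_remnantSupply.1 hu).2 i)) (by omega)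
        have h2 := hs.budget_nonneg i
        simp only [surplusBound, Function.update_self]
        rw [Nat.cast_zero, mul_zero, min_eq_left h2]
        linarith
      · simp [hi]

/-! ### Raising the price, and the invariant of the auction. -/

theorem Consistent.raisePrice {I : Input n} {s : State n} (hs : Consistent I s) {c : ℝ}
    (hc : IsLeast {c : ℝ | s.c ≤ c ∧ ∃ j, BidReached I s c j ∨ BudgetReached I s c j} c) :
    Consistent I { s with c := c } where
  price_nonneg := hs.price_nonneg.trans hc.1.1
  price_le_bid i hi := hc.2 ⟨hs.price_le_bid i hi, i, Or.inl ⟨hi, rfl⟩⟩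
  demand_le i := by
    dsimp only
    rcases Nat.eq_zero_or_pos (s.d i) with h0 | h0
    · simpa [h0] using hs.budget_nonneg i
    · have hd : (0 : ℝ) < s.d i := by exact_mod_cast h0
      have hb := hs.budget_pos i h0
      rw [← le_div_iff₀ hd]
      -- The price `(B - p) / d` is itself a stopping price, so the clock cannot pass it. Positivity
      -- of the remaining budget keeps this price nonzero, as the quotient by it requires.
      refine hc.2 ⟨(le_div_iff₀ hd).2 (hs.demand_le i), i, Or.inr ⟨h0, ?_⟩⟩
      field_simp
  budget_pos := hs.budget_pos

theorem WelfareBound.raisePrice {I : Input n} {s : State n} {L c : ℝ} (h : WelfareBound I s L)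
    (hc : s.c ≤ c) : WelfareBound I { s with c := c } L := by
  obtain ⟨u, a, hu, hau, hL⟩ := h
  refine ⟨u, a, hu, hau, hL.trans (Finset.sum_le_sum fun i _ => ?_)⟩
  have : (a i : ℝ) ≤ u i := by exact_mod_cast hau i
  simp only [surplusBound]
  gcongr

/-- The invariant of the auction. -/
structure Invariant (I : Input n) (L : ℝ) (s : State n) : Prop where
  consistent : Consistent I s
  welfareBound : WelfareBound I s L
  settled : Settled I.f s

theorem Invariant.clinching_setDemand {I : Input n} {L : ℝ} {s : State n} (h : Invariant I L s)
    {j : Fin n} {m : ℕ} (hmd : m ≤ s.d j)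
    (hm : ∀ a : ℕ, a ≤ s.d j → m < a → min (I.bid j * a) (I.budget j - s.p j) ≤ s.c * a) :
    Invariant I L (clinching I.f (s.setDemand j m)) := by
  have h2 := h.welfareBound.setDemand h.consistent h.settled hm
  have h3 := foldl_clinchBuyer_invariant (List.finRange n) (h.consistent.setDemand hmd) h2
  exact ⟨h3.1, h3.2, settled_clinching h2.mem_polymatroid⟩

theorem Invariant.step {I : Input n} {L : ℝ} {a b : Control × State n} (h : Invariant I L a.2)
    (hab : Step I a b) : Invariant I L b.2 := by
  cases hab with
  | raisePrice s c' _ hc =>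
    exact ⟨h.consistent.raisePrice hc, h.welfareBound.raisePrice hc.1.1, h.settled⟩
  | updateBid s j hj =>
    exact h.clinching_setDemand (Nat.zero_le _) fun a _ _ => by
      rw [hj.2]; exact min_le_left _ _
  | exitBids s _ => exact h
  | updateBudget s j hj =>
    refine h.clinching_setDemand (Nat.sub_le _ _) fun a h1 h2 => (min_le_right _ _).trans ?_
    -- Since the demand drops by one, only `a = d j` violates the new demand, and its price is
    -- exactly the remaining budget.
    have ha : a = s.d j := le_antisymm h1 (Nat.le_of_pred_lt h2)
    have hd : (0 : ℝ) < s.d j := by exact_mod_cast hj.1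
    have h3 := hj.2
    have hc : s.c ≠ 0 := by
      intro h0
      rw [h0, div_zero] at h3
      exact hd.ne' h3
    rw [eq_div_iff hc] at h3
    dsimp only
    rw [ha, ← h3, mul_comm]
  | exitBudgets s _ => exact h

theorem Reachable.invariant {I : Input n} {a : Control × State n} (h : Reachable I a) :
    Invariant I (optLiquidWelfare I.f I.bid I.budget) a.2 := by
  induction h with
  | refl =>
    exact ⟨consistent_initialState I, welfareBound_initialState I, settled_initialState I⟩
  | tail _ hab ih => exact ih.step hab

theorem le_socialWelfare {I : Input n} {L : ℝ} {s : State n} (h : Invariant I L s)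
    (hs : ¬ ∃ i, s.Active i) : L ≤ socialWelfare I.bid ⟨s.x, s.p⟩ := by
  obtain ⟨u, a, hu, hau, hL⟩ := h.welfareBound
  refine hL.trans (Finset.sum_le_sum fun i _ => ?_)
  have hd : s.d i = 0 := Nat.eq_zero_of_not_pos fun hi => hs ⟨i, hi⟩
  have hui : u i = 0 := Nat.le_zero.1 (hd ▸ (natCast_mem_remnantSupply.1 hu).2 i)
  have hai : a i = 0 := Nat.le_zero.1 (hui ▸ hau i)
  simp [surplusBound, hui, hai]

/-! ### Progress and termination. -/

theorem exists_raisePrice {I : Input n} {s : State n} (hs : Consistent I s)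
    (hact : ∃ i, s.Active i) :
    ∃ c, IsLeast {c : ℝ | s.c ≤ c ∧ ∃ j, BidReached I s c j ∨ BudgetReached I s c j} c := by
  -- Each buyer contributes at most two stopping prices, her bid and `(B - p) / d`, so a least one
  -- exists.
  have hfin : {c : ℝ | s.c ≤ c ∧ ∃ j, BidReached I s c j ∨ BudgetReached I s c j}.Finite := by
    refine ((Set.finite_range I.bid).union
      (Set.finite_range fun j => (I.budget j - s.p j) / s.d j)).subset ?_
    rintro c ⟨-, j, h | h⟩
    · exact Or.inl ⟨j, h.2⟩
    · refine Or.inr ⟨j, ?_⟩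
      have hd : (s.d j : ℝ) ≠ 0 := by exact_mod_cast (show s.d j ≠ 0 from h.1.ne')
      have h3 := h.2
      have hc : c ≠ 0 := by
        rintro rfl
        rw [div_zero] at h3
        exact hd h3
      rw [eq_div_iff hc] at h3
      rw [div_eq_iff hd, ← h3, mul_comm]
  obtain ⟨i, hi⟩ := hact
  obtain ⟨c, hc, hmin⟩ := Set.exists_min_image _ id hfin
    ⟨I.bid i, hs.price_le_bid i hi, i, Or.inl ⟨hi, rfl⟩⟩
  exact ⟨c, hc, hmin⟩

theorem exists_step {I : Input n} {L : ℝ} {a : Control × State n} (h : Invariant I L a.2) :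
    Ended a ∨ ∃ b, Step I a b := by
  obtain ⟨k, s⟩ := a
  cases k with
  | outer =>
    by_cases hact : ∃ i, s.Active i
    · obtain ⟨c, hc⟩ := exists_raisePrice h.consistent hact
      exact Or.inr ⟨_, .raisePrice s c hact hc⟩
    · exact Or.inl ⟨rfl, hact⟩
  | bids =>
    by_cases hj : ∃ j, BidReached I s s.c j
    · exact Or.inr ⟨_, .updateBid s _ hj.choose_spec⟩
    · exact Or.inr ⟨_, .exitBids s hj⟩
  | budgets =>
    by_cases hj : ∃ j, BudgetReached I s s.c j
    · exact Or.inr ⟨_, .updateBudget s _ hj.choose_spec⟩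
    · exact Or.inr ⟨_, .exitBudgets s hj⟩

open scoped Classical in
/-- The number of steps that are possible before the next update of a demand. -/
noncomputable def stepsToUpdate (I : Input n) : Control × State n → ℕ
  | (.outer, _) => 3
  | (.bids, s) => if ∃ j, BidReached I s s.c j ∨ BudgetReached I s s.c j then 2 else 5
  | (.budgets, s) => if ∃ j, BudgetReached I s s.c j then 1 else 4

theorem stepsToUpdate_lt (I : Input n) (a : Control × State n) : stepsToUpdate I a < 6 := by
  obtain ⟨k, s⟩ := a
  cases k <;> simp only [stepsToUpdate] <;> try split_ifs
  all_goals omega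

theorem sum_demand_foldl_clinchBuyer_le (f : Finset (Fin n) → ℕ) (l : List (Fin n))
    (s : State n) : ∑ i, (l.foldl (clinchBuyer f) s).d i ≤ ∑ i, s.d i := by
  induction l generalizing s with
  | nil => exact le_rfl
  | cons i l ih =>
    refine (ih _).trans (Finset.sum_le_sum fun k _ => ?_)
    rcases eq_or_ne k i with rfl | hk <;> simp [clinchBuyer, *]

theorem sum_demand_clinching_lt (f : Finset (Fin n) → ℕ) {s : State n} {j : Fin n} {m : ℕ}
    (hm : m < s.d j) : ∑ i, (clinching f (s.setDemand j m)).d i < ∑ i, s.d i := by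
  refine (sum_demand_foldl_clinchBuyer_le f _ _).trans_lt
    (Finset.sum_lt_sum (fun k _ => ?_) ⟨j, Finset.mem_univ j, by simpa [State.setDemand] using hm⟩)
  rcases eq_or_ne k j with rfl | hk
  · simpa [State.setDemand] using hm.le
  · simp [State.setDemand, hk]

/-- Updates lower the total demand, and the factor 6 outweighs any reset of `stepsToUpdate`. Between
updates the control can at worst run through the values 5, 4, 3, 2, 1: a raised price always
triggers some buyer, so a loop without an update is impossible. -/
theorem Step.measure_lt {I : Input n} {a b : Control × State n} (h : Step I a b) :
    6 * ∑ i, b.2.d i + stepsToUpdate I b < 6 * ∑ i, a.2.d i + stepsToUpdate I a := by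
  cases h with
  | raisePrice s c' _ hc =>
    have : ∃ j, BidReached I { s with c := c' } c' j ∨ BudgetReached I { s with c := c' } c' j :=
      hc.1.2
    simp [stepsToUpdate, this]
  | updateBid s j hj =>
    have h1 := sum_demand_clinching_lt I.f (s := s) (j := j) (m := 0) hj.1
    have h2 := stepsToUpdate_lt I (.bids, clinching I.f (s.setDemand j 0))
    dsimp only
    omega
  | exitBids s hs =>
    have : (∃ j, BidReached I s s.c j ∨ BudgetReached I s s.c j) ↔
        ∃ j, BudgetReached I s s.c j := by
      rw [exists_or]
      exact or_iff_right hs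
    by_cases hb : ∃ j, BudgetReached I s s.c j
    · simp [stepsToUpdate, this.2 hb, hb]
    · simp [stepsToUpdate, mt this.1 hb, hb]
  | updateBudget s j hj =>
    have h1 := sum_demand_clinching_lt I.f (s := s) (j := j) (m := s.d j - 1)
      (Nat.sub_lt hj.1 one_pos)
    have h2 := stepsToUpdate_lt I (.budgets, clinching I.f (s.setDemand j (s.d j - 1)))
    dsimp only
    omega
  | exitBudgets s hs => simp [stepsToUpdate, hs]

theorem terminates (I : Input n) : Terminates I := by
  refine ⟨?_, fun a ha => exists_step ha.invariant⟩
  have hwf : WellFounded fun b a : Control × State n => Step I a b :=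
    Subrelation.wf (r := InvImage (· < ·) fun a => 6 * ∑ i, a.2.d i + stepsToUpdate I a)
      (fun h => Step.measure_lt h) (InvImage.wf _ Nat.lt_wfRel.wf)
  exact hwf.apply _

end ClinchingAuction

theorem theorem5p5 {n : ℕ} (I : ClinchingAuction.Input n) (v : Fin n → ℝ)
    (truthful : ∀ i, I.bid i = v i) :
    ClinchingAuction.Terminates I ∧
      ∀ A : ClinchingAuction.Allocation n, ClinchingAuction.IsFinalAllocation I A →
        ClinchingAuction.optLiquidWelfare I.f v I.budget ≤
          ClinchingAuction.socialWelfare v A := by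
  obtain rfl : I.bid = v := funext truthful
  refine ⟨ClinchingAuction.terminates I, ?_⟩
  rintro A ⟨a, ha, hend, rfl⟩
  exact ClinchingAuction.le_socialWelfare ha.invariant hend.2
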